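/- For an integer $n\ge 1$ and $k\in\mathbb{R}$ let $\Phi_{n,k}$ be the real symmetric operator on an $(n+1)$-dimensional space with orthonormal basis $e_1,\dots,e_{n+1}$ whose only nonzero matrix entries are $$\langle e_{y+1},\Phi_{n,k}e_y\rangle=\langle e_y,\Phi_{n,k}e_{y+1}\rangle=2\ (1\le y\le n-1),\qquad \langle e_{n+1},\Phi_{n,k}e_n\rangle=\langle e_n,\Phi_{n,k}e_{n+1}\rangle=2\sin k,\qquad \langle e_{n+1},\Phi_{n,k}e_{n+1}\rangle=4\cos k .$$ For even $n\ge 2$ let $\lambda(k)=\lambda^{(n)}(k)$ be the median, i.e. the $\frac{n+2}{2}$-th largest, eigenvalue of $\Phi_{n,k}$. Let $\Lambda(k)=4\arctan\left(\frac{2\cos k}{\sin^2 k}\right)$, extended by continuity to the points with $\sin k=0$, where $\Lambda(k)=2\pi\cos k$. A prime denotes the derivative with respect to $k$. Then $\Lambda$ and, for every even $n\ge 2$, $\lambda$ are twice continuously differentiable on $\mathbb{R}$, and: 1. For every even $n\ge 2$ and every $k\in\mathbb{R}$, $\lambda'(k)$ lies between $\frac{\Lambda'(k)}{n}\left(1-\frac{2}{n}\right)$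 and $\frac{\Lambda'(k)}{n}\left(1+\frac{2}{n}\right)$ (inclusive). 2. There is a constant $a>0$ such that $\left|\lambda''(k)-\frac{\Lambda''(k)}{n}\right|\le\frac{a}{n^2}$ for all even $n\ge 2$ and all $k\in\mathbb{R}$. 3. There is $n_0\in\mathbb{N}$ such that for all even $n\ge \max(n_0,2)$ and all $k\in\mathbb{R}$ we have $\lambda''(k)=0$ if and only if $k\equiv\frac{\pi}{2}\pmod\pi$. -/

import Mathlib

open Real

/-- The operator `Φ_{n,k}` in the orthonormal basis `|1̄⟩, …, |n+1̄⟩`: the vector `|ȳ⟩` is the one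
with index `y - 1 : Fin (n + 1)`. All entries vanish except for `2` between consecutive vectors
`|ȳ⟩`, `|y+1̄⟩` with `1 ≤ y ≤ n - 1`, `2 sin k` between `|n̄⟩` and `|n+1̄⟩`, and the diagonal entry
`4 cos k` at `|n+1̄⟩`. -/
noncomputable def snakePhi (n : ℕ) (k : ℝ) : Matrix (Fin (n + 1)) (Fin (n + 1)) ℝ :=
  Matrix.of fun i j =>
    if i = j then
      if (i : ℕ) = n then 4 * cos k else 0
    else if (i : ℕ) + 1 = j ∨ (j : ℕ) + 1 = i then
      if (i : ℕ) = n ∨ (j : ℕ) = n then 2 * sin k else 2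
    else 0

theorem snakePhi_isHermitian (n : ℕ) (k : ℝ) : (snakePhi n k).IsHermitian := by
  ext i j
  simp only [snakePhi, Matrix.conjTranspose_apply, Matrix.of_apply, star_trivial]
  by_cases h : i = j
  · subst h; rfl
  · simp only [if_neg h, if_neg (Ne.symm h), or_comm]

/-- The eigenvalue `λ(k)` of `Φ_{n,k}`. `eigenvalues₀` lists the `n + 1` eigenvalues in decreasing
order starting from index `0`, so index `n / 2` is, for even `n`, the `(n + 2) / 2`-th largest
eigenvalue, that is, the median one. -/
noncomputable def medianEigenvalue (n : ℕ) (k : ℝ) : ℝ :=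
  (snakePhi_isHermitian n k).eigenvalues₀
    ⟨n / 2, by rw [Fintype.card_fin]; exact Nat.lt_succ_of_le (Nat.div_le_self n 2)⟩

/-- `Λ(k) = 4 arctan (2 cos k / sin² k)`, where at the points `sin k = 0` (so `cos k = ±1`) the
arctangent is read as its limit `±π/2`, which makes the value `±2π = 2π cos k`. -/
noncomputable def limitLambda (k : ℝ) : ℝ :=
  if sin k = 0 then 2 * π * cos k else 4 * arctan (2 * cos k / sin k ^ 2)

/-! Write c = cos k and n = 2m. A sine wave a sin(yθ) on the first n sites solves the bulk equations
with eigenvalue 4 cos θ, and for sin k ≠ 0 the last two rows reduce to nθ + 2 arctan((c - cos θ)/sin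
θ) ∈ πℤ. This phase increases strictly from -π to (n+1)π on (0, π), so the values 0, π, …, nπ give
all n+1 eigenvalues in order, and the median one has phase mπ. With θ = π/2 - φ this reads c = sin φ
+ cos φ tan(mφ), λ = 4 sin φ; the same formula holds at sin k = 0 (`medianEigenvalue_eq`).

Inverting this curve makes x = λ/4 a C² function of c with dx/dc = 2(1 - x²)/(n(1 + c²) + 2 -
2(n+1)cx), where cx ≥ 0 and |x| ≤ 2|c|/(n+2) (`sin_bounds`). To leading order dx/dc is 2/(n(1 +
c²)), and Λ = 8 arctan c (`limitLambda_eq`). Claim 1 is `snakeSlope_mul_mem`; claim 2 combines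
`abs_snakeSlope_sub_le` and `abs_snakeCurvature_sub_le`. The second-order error carries a factor
|cos k|, while |Λ''| ≥ 4|cos k|; hence claim 3. -/

/-! ### Ordered spectrum and the sine-wave eigenvectors -/

/-- Locating each `f i` in the sorted list gives a strictly increasing self-map of `Fin N`, which
can only be the identity. -/
theorem Matrix.IsHermitian.eigenvalues₀_eq_of_strictAnti {N : ℕ} {A : Matrix (Fin N) (Fin N) ℝ}
    (hA : A.IsHermitian) {f : Fin N → ℝ} (hf : StrictAnti f)
    (hv : ∀ i, ∃ v : Fin N → ℝ, v ≠ 0 ∧ A.mulVec v = f i • v) (i : Fin (Fintype.card (Fin N))) :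
    hA.eigenvalues₀ i = f (Fin.cast (Fintype.card_fin N) i) := by
  have key : ∀ i : Fin N, ∃ j : Fin (Fintype.card (Fin N)), hA.eigenvalues₀ j = f i := by
    intro i
    obtain ⟨v, hv0, hv⟩ := hv i
    have h1 : f i ∈ spectrum ℝ A := by
      rw [← Matrix.spectrum_toLin', ← Module.End.hasEigenvalue_iff_mem_spectrum]
      refine Module.End.hasEigenvalue_of_hasEigenvector (x := v) ?_
      rw [Module.End.hasEigenvector_iff, Module.End.mem_eigenspace_iff]
      exact ⟨by rw [Matrix.toLin'_apply, hv], hv0⟩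
    rw [hA.spectrum_real_eq_range_eigenvalues] at h1
    obtain ⟨j, hj⟩ := h1
    exact ⟨_, hj⟩
  choose τ hτ using key
  have hmono : StrictMono fun i => Fin.cast (Fintype.card_fin N) (τ i) := by
    intro a b hab
    have h1 : hA.eigenvalues₀ (τ b) < hA.eigenvalues₀ (τ a) := by
      rw [hτ, hτ]; exact hf hab
    have h2 : τ a < τ b := by
      by_contra h
      exact absurd (hA.eigenvalues₀_antitone (not_lt.mp h)) (not_le.mpr h1)
    exact h2
  have hid := congrFun hmono.eq_id (Fin.cast (Fintype.card_fin N) i)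
  rw [← hτ]
  congr 1
  apply Fin.ext
  have := congrArg Fin.val hid
  simpa using this.symm

theorem snakePhi_mulVec (n : ℕ) (k : ℝ) (w : ℕ → ℝ) (i : Fin (n + 1)) :
    (snakePhi n k).mulVec (fun j => w j) i =
      (if (i : ℕ) = n then 4 * cos k * w i else 0)
      + (if (i : ℕ) < n then (if (i : ℕ) + 1 = n then 2 * sin k else 2) * w (i + 1) else 0)
      + (if 0 < (i : ℕ) then (if (i : ℕ) = n then 2 * sin k else 2) * w (i - 1) else 0) := by
  obtain ⟨i, hi⟩ := i
  have h : ∀ j : Fin (n + 1), snakePhi n k ⟨i, hi⟩ j * w j =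
      (if i = (j : ℕ) then (if i = n then 4 * cos k * w i else 0) else 0)
      + (if i + 1 = (j : ℕ) then (if i + 1 = n then 2 * sin k else 2) * w (i + 1) else 0)
      -- At `i = 0` the truncated `i - 1` is again `0`, so the inner test `0 < i` is what removes
      -- the spurious term.
      + (if i - 1 = (j : ℕ) then
          (if 0 < i then (if i = n then 2 * sin k else 2) * w (i - 1) else 0) else 0) := by
    rintro ⟨j, hj⟩
    simp only [snakePhi, Matrix.of_apply, Fin.mk.injEq]
    rcases Nat.lt_trichotomy i j with hij | rfl | hij
    · by_cases h1 : i + 1 = j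
      · subst h1
        have : i ≠ n := by omega
        simp [this]
      · have h2 : ¬ j + 1 = i := by omega
        have h3 : i - 1 ≠ j := by omega
        have h4 : i ≠ j := by omega
        simp [h1, h2, h3, h4]
    · by_cases h0 : 0 < i
      · have h3 : i - 1 ≠ i := by omega
        simp [h3]
      · obtain rfl : i = 0 := by omega
        simp
    · by_cases h1 : j + 1 = i
      · subst h1
        have : j ≠ n := by omega
        have h5 : ¬ j + 1 + 1 = j := by omega
        simp [this, h5]
      · have h2 : ¬ i + 1 = j := by omega
        have h3 : i - 1 ≠ j := by omega
        have h4 : i ≠ j := by omega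
        simp [h1, h2, h3, h4]
  simp only [Matrix.mulVec, dotProduct, h]
  rw [Finset.sum_add_distrib, Finset.sum_add_distrib]
  congr 1
  · congr 1
    · rw [Fin.sum_univ_eq_sum_range (fun j => if i = j then (if i = n then 4 * cos k * w i else 0)
        else 0), Finset.sum_ite_eq, if_pos (Finset.mem_range.mpr hi)]
    · rw [Fin.sum_univ_eq_sum_range (fun j => if i + 1 = j then
        (if i + 1 = n then 2 * sin k else 2) * w (i + 1) else 0), Finset.sum_ite_eq]
      simp
  · rw [Fin.sum_univ_eq_sum_range (fun j => if i - 1 = j then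
        (if 0 < i then (if i = n then 2 * sin k else 2) * w (i - 1) else 0) else 0),
        Finset.sum_ite_eq, if_pos (Finset.mem_range.mpr (by omega))]

/-- `h1` says that `sin k * b` continues the sine wave to site n+1, which settles row n; `h2` is
half of the last row. Keeping `a` and `b` free also covers sin k = 0, where the last site decouples.
-/
theorem snakePhi_exists_eigenvector {n : ℕ} (hn : 0 < n) {k θ a b : ℝ}
    (hab : a * sin θ ≠ 0 ∨ b ≠ 0) (h1 : sin k * b = a * sin ((n + 1) * θ))
    (h2 : sin k * a * sin (n * θ) + 2 * cos k * b = 2 * cos θ * b) :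
    ∃ v : Fin (n + 1) → ℝ, v ≠ 0 ∧ (snakePhi n k).mulVec v = (4 * cos θ) • v := by
  set w : ℕ → ℝ := fun j => if j < n then a * sin ((j + 1) * θ) else b with hw
  have hwn : w n = b := by simp [hw]
  have hwl : ∀ j, j < n → w j = a * sin ((j + 1) * θ) := fun j hj => by simp [hw, hj]
  refine ⟨fun j => w j, ?_, ?_⟩
  · intro h
    rcases hab with h0 | h0
    · apply h0
      have := congrFun h 0
      simpa [hw, hn] using this
    · apply h0
      have := congrFun h (Fin.last n)
      simpa [hw] using this
  · have hrec : ∀ x : ℝ, 2 * sin ((x + 2) * θ) + 2 * sin (x * θ)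
        = 4 * cos θ * sin ((x + 1) * θ) := by
      intro x
      have e1 : (x + 2) * θ = (x + 1) * θ + θ := by ring
      have e2 : x * θ = (x + 1) * θ - θ := by ring
      rw [e1, e2, sin_add, sin_sub]; ring
    ext i
    rw [snakePhi_mulVec]
    obtain ⟨i, hi⟩ := i
    simp only [Pi.smul_apply, smul_eq_mul]
    rcases Nat.lt_or_ge i n with hin | hin
    · have hup : (if i + 1 = n then 2 * sin k else 2) * w (i + 1)
          = 2 * (a * sin ((i + 2) * θ)) := by
        split_ifs with h
        · have : (i : ℝ) + 2 = n + 1 := by rw [← h]; push_cast; ring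
          rw [h, hwn, this, ← h1]; ring
        · rw [hwl (i + 1) (by omega)]; push_cast; ring_nf
      have hdown : (if 0 < i then (if i = n then 2 * sin k else 2) * w (i - 1) else 0)
          = 2 * (a * sin (i * θ)) := by
        split_ifs with h h'
        · omega
        · rw [hwl (i - 1) (by omega), Nat.cast_sub (by omega)]; push_cast; ring_nf
        · obtain rfl : i = 0 := by omega
          simp
      rw [if_neg (by omega), if_pos hin, hup, hdown, hwl i hin]
      linear_combination a * hrec i
    · obtain rfl : i = n := by omega
      rw [if_pos rfl, if_neg (by omega), if_pos hn, if_pos rfl, hwn, hwl (i - 1) (by omega),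
        Nat.cast_sub (by omega)]
      push_cast
      rw [sub_add_cancel]
      linear_combination 2 * h2

/-! ### The curve c = sin φ + cos φ tan(mφ) and its inverse -/

/-- The curve `φ ↦ cos k` along which `4 sin φ` is the median eigenvalue of `snakePhi (2 * m) k`. -/
noncomputable def snakeCurve (m : ℕ) (φ : ℝ) : ℝ := sin φ + cos φ * tan (m * φ)

/-- The interval on which `snakeCurve m` is inverted. -/
def snakeInterval (m : ℕ) : Set ℝ := Set.Ioo (-(π / (2 * (m + 1)))) (π / (2 * (m + 1)))

theorem abs_mul_lt_of_mem_snakeInterval {m : ℕ} {φ : ℝ} (h : φ ∈ snakeInterval m) :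
    (m + 1) * |φ| < π / 2 := by
  have h1 : |φ| < π / (2 * (m + 1)) := abs_lt.mpr h
  rw [lt_div_iff₀ (by positivity)] at h1
  linarith

theorem cos_mul_pos_of_mem_snakeInterval {m : ℕ} {φ x : ℝ} (h : φ ∈ snakeInterval m) (hx : 0 ≤ x)
    (hxm : x ≤ m + 1) : 0 < cos (x * φ) := by
  have h1 := abs_mul_lt_of_mem_snakeInterval h
  have h2 : |x * φ| < π / 2 := by
    rw [abs_mul, abs_of_nonneg hx]
    exact lt_of_le_of_lt (mul_le_mul_of_nonneg_right hxm (abs_nonneg _)) h1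
  exact cos_pos_of_mem_Ioo (abs_lt.mp h2)

theorem cos_pos_of_mem_snakeInterval {m : ℕ} {φ : ℝ} (h : φ ∈ snakeInterval m) : 0 < cos φ := by
  simpa using cos_mul_pos_of_mem_snakeInterval h zero_le_one (by linarith [m.cast_nonneg (α := ℝ)])

theorem cos_nat_mul_pos_of_mem_snakeInterval {m : ℕ} {φ : ℝ} (h : φ ∈ snakeInterval m) :
    0 < cos (m * φ) :=
  cos_mul_pos_of_mem_snakeInterval h m.cast_nonneg (by linarith)

theorem snakeCurve_mul_cos {m : ℕ} {φ : ℝ} (h : cos (m * φ) ≠ 0) :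
    snakeCurve m φ * cos (m * φ) = sin ((m + 1) * φ) := by
  rw [snakeCurve, tan_eq_sin_div_cos, add_one_mul (m : ℝ) φ, sin_add]
  field_simp
  ring

theorem snakeCurve_neg (m : ℕ) (φ : ℝ) : snakeCurve m (-φ) = -snakeCurve m φ := by
  simp only [snakeCurve, sin_neg, cos_neg, mul_neg, tan_neg]; ring

/-- The derivative of `snakeCurve m`. -/
noncomputable def snakeCurveDeriv (m : ℕ) (φ : ℝ) : ℝ :=
  cos φ + (-sin φ * tan (m * φ) + cos φ * (1 / cos (m * φ) ^ 2 * m))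

theorem hasStrictDerivAt_snakeCurve {m : ℕ} {φ : ℝ} (h : φ ∈ snakeInterval m) :
    HasStrictDerivAt (snakeCurve m) (snakeCurveDeriv m φ) φ := by
  have h1 : HasStrictDerivAt (fun x : ℝ => tan (m * x)) (1 / cos (m * φ) ^ 2 * m) φ := by
    have h2 : HasStrictDerivAt (fun x : ℝ => (m : ℝ) * x) m φ := by
      simpa using (hasStrictDerivAt_id φ).const_mul (m : ℝ)
    exact (hasStrictDerivAt_tan (cos_nat_mul_pos_of_mem_snakeInterval h).ne').comp φ h2
  exact (hasStrictDerivAt_sin φ).add ((hasStrictDerivAt_cos φ).mul h1)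

/-- Since cos φ tan(mφ) = c - sin φ, the tangent can be eliminated. What remains involves only c and
sin φ, which yields the differential equation for sin φ. -/
theorem snakeCurveDeriv_mul_cos {m : ℕ} {φ : ℝ} (h : φ ∈ snakeInterval m) :
    snakeCurveDeriv m φ * cos φ = 1 - snakeCurve m φ * sin φ
      + m * (1 - 2 * snakeCurve m φ * sin φ + snakeCurve m φ ^ 2) := by
  have hT : 1 / cos (m * φ) ^ 2 = 1 + tan (m * φ) ^ 2 := by
    rw [← inv_one_add_tan_sq (cos_nat_mul_pos_of_mem_snakeInterval h).ne', one_div, inv_inv]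
  rw [snakeCurveDeriv, snakeCurve, hT]
  linear_combination (1 + m) * sin_sq_add_cos_sq φ

theorem snakeCurveDeriv_pos {m : ℕ} (hm : 0 < m) {φ : ℝ} (h : φ ∈ snakeInterval m) :
    0 < snakeCurveDeriv m φ := by
  have h0 := cos_pos_of_mem_snakeInterval h
  have h1 := cos_nat_mul_pos_of_mem_snakeInterval h
  have h2 := cos_mul_pos_of_mem_snakeInterval h (x := m + 1) (by positivity) le_rfl
  have hm' : (0 : ℝ) < m := by exact_mod_cast hm
  -- Positivity of cos((m+1)φ) in this form is what the width of `snakeInterval` provides.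
  have h3 : snakeCurveDeriv m φ
      = (cos ((m + 1) * φ) * cos (m * φ) + m * cos φ) / cos (m * φ) ^ 2 := by
    rw [snakeCurveDeriv, tan_eq_sin_div_cos, add_one_mul (m : ℝ) φ, cos_add]
    field_simp
    ring
  rw [h3]
  positivity

theorem strictMonoOn_snakeCurve {m : ℕ} (hm : 0 < m) :
    StrictMonoOn (snakeCurve m) (snakeInterval m) := by
  refine strictMonoOn_of_deriv_pos (convex_Ioo _ _)
    (fun x hx => (hasStrictDerivAt_snakeCurve hx).hasDerivAt.continuousAt.continuousWithinAt) ?_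
  intro x hx
  have hx := interior_subset hx
  rw [(hasStrictDerivAt_snakeCurve hx).hasDerivAt.deriv]
  exact snakeCurveDeriv_pos hm hx

theorem pi_div_mem_snakeInterval {m : ℕ} (hm : 0 < m) :
    π / (2 * (2 * m + 1)) ∈ snakeInterval m := by
  have hm' : (0 : ℝ) < m := by exact_mod_cast hm
  have hp := pi_pos
  refine ⟨lt_trans (neg_neg_of_pos (by positivity)) (by positivity), ?_⟩
  apply div_lt_div_of_pos_left hp (by positivity)
  linarith

/-- At this angle (m+1)φ and mφ are complementary. The point is interior to `snakeInterval`, so the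
inverse is smooth even at c = ±1. -/
theorem snakeCurve_pi_div {m : ℕ} (hm : 0 < m) : snakeCurve m (π / (2 * (2 * m + 1))) = 1 := by
  have h := cos_nat_mul_pos_of_mem_snakeInterval (pi_div_mem_snakeInterval hm)
  have h1 := snakeCurve_mul_cos h.ne'
  have h2 : (m + 1) * (π / (2 * (2 * m + 1))) = π / 2 - m * (π / (2 * (2 * m + 1))) := by
    field_simp; ring
  rw [h2, sin_pi_div_two_sub] at h1
  exact mul_right_cancel₀ h.ne' (by rw [h1, one_mul])

theorem exists_snakeCurve_eq {m : ℕ} (hm : 0 < m) {c : ℝ} (hc : c ∈ Set.Icc (-1 : ℝ) 1) :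
    ∃ φ ∈ snakeInterval m, snakeCurve m φ = c := by
  set α : ℝ := π / (2 * (2 * m + 1)) with hα
  have hmem := pi_div_mem_snakeInterval hm
  have hα0 : 0 < α := by have := pi_pos; positivity
  have hsub : Set.Icc (-α) α ⊆ snakeInterval m := fun x hx =>
    ⟨lt_of_lt_of_le (neg_lt_neg hmem.2) hx.1, lt_of_le_of_lt hx.2 hmem.2⟩
  have hcont : ContinuousOn (snakeCurve m) (Set.Icc (-α) α) := fun x hx =>
    (hasStrictDerivAt_snakeCurve (hsub hx)).hasDerivAt.continuousAt.continuousWithinAt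
  have := intermediate_value_Icc (by linarith) hcont
  rw [snakeCurve_neg, hα, snakeCurve_pi_div hm] at this
  obtain ⟨φ, hφ, h⟩ := this hc
  exact ⟨φ, hsub hφ, h⟩

/-- The inverse of `snakeCurve m` on `snakeInterval m`. -/
noncomputable def snakeAngle (m : ℕ) (c : ℝ) : ℝ :=
  Function.invFunOn (snakeCurve m) (snakeInterval m) c

theorem snakeAngle_mem {m : ℕ} (hm : 0 < m) {c : ℝ} (hc : c ∈ Set.Icc (-1 : ℝ) 1) :
    snakeAngle m c ∈ snakeInterval m :=
  Function.invFunOn_mem (exists_snakeCurve_eq hm hc)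

theorem snakeCurve_snakeAngle {m : ℕ} (hm : 0 < m) {c : ℝ} (hc : c ∈ Set.Icc (-1 : ℝ) 1) :
    snakeCurve m (snakeAngle m c) = c :=
  Function.invFunOn_eq (exists_snakeCurve_eq hm hc)

theorem snakeAngle_contDiffAt_hasDerivAt {m : ℕ} (hm : 0 < m) {c : ℝ}
    (hc : c ∈ Set.Icc (-1 : ℝ) 1) :
    ContDiffAt ℝ 2 (snakeAngle m) c ∧
      HasDerivAt (snakeAngle m) (snakeCurveDeriv m (snakeAngle m c))⁻¹ c := by
  set a := snakeAngle m c with ha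
  have haJ : a ∈ snakeInterval m := snakeAngle_mem hm hc
  have hac : snakeCurve m a = c := snakeCurve_snakeAngle hm hc
  have hd := hasStrictDerivAt_snakeCurve haJ
  have hpos := snakeCurveDeriv_pos hm haJ
  have hd' := hd.hasStrictFDerivAt_equiv hpos.ne'
  have hcd : ContDiffAt ℝ 2 (snakeCurve m) a := by
    have h1 : ContDiffAt ℝ 2 (fun x : ℝ => tan (m * x)) a :=
      ContDiffAt.comp (f := fun x : ℝ => (m : ℝ) * x) a
        (contDiffAt_tan.mpr (cos_nat_mul_pos_of_mem_snakeInterval haJ).ne') (by fun_prop)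
    exact contDiff_sin.contDiffAt.add (contDiff_cos.contDiffAt.mul h1)
  -- Values near c may lie outside [-1, 1], but the local inverse still lands in the open interval,
  -- so injectivity there identifies it with the chosen inverse.
  have hloc : hd'.localInverse (snakeCurve m) _ a =ᶠ[nhds c] snakeAngle m := by
    have h1 := hd'.eventually_right_inverse
    have h2 := hd'.localInverse_continuousAt
    have h3 := hd'.localInverse_apply_image
    rw [hac] at h1 h2 h3
    have h4 := h2.preimage_mem_nhds (by rw [h3]; exact isOpen_Ioo.mem_nhds haJ)
    filter_upwards [h1, h4] with y hy1 hy2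
    have hex : ∃ φ ∈ snakeInterval m, snakeCurve m φ = y := ⟨_, hy2, hy1⟩
    exact (strictMonoOn_snakeCurve hm).injOn hy2 (Function.invFunOn_mem hex)
      (hy1.trans (Function.invFunOn_eq hex).symm)
  constructor
  · have := hcd.to_localInverse hd'.hasFDerivAt (by norm_num)
    rw [hac] at this
    exact this.congr_of_eventuallyEq hloc.symm
  · have := (hd.to_localInverse hpos.ne').hasDerivAt
    rw [hac] at this
    exact this.congr_of_eventuallyEq hloc.symm

/-- This is m tan φ ≤ tan(mφ) with denominators cleared; each induction step gains (m+1) sin²φ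
sin(mφ) ≥ 0. -/
theorem nat_mul_sin_mul_cos_le {φ : ℝ} (m : ℕ)
    (h : ∀ j < m, 0 ≤ sin (j * φ)) (hc : 0 ≤ cos φ) :
    m * (sin φ * cos (m * φ)) ≤ cos φ * sin (m * φ) := by
  induction m with
  | zero => simp
  | succ m ih =>
    have ih := ih fun j hj => h j (by omega)
    have h1 := mul_le_mul_of_nonneg_right ih hc
    have h2 : 0 ≤ (m + 1) * (sin φ ^ 2 * sin (m * φ)) :=
      mul_nonneg (by positivity) (mul_nonneg (by positivity) (h m (by omega)))
    push_cast
    rw [add_mul (m : ℝ) 1 φ, one_mul, sin_add, cos_add]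
    nlinarith

theorem sin_bounds_of_nonneg {m : ℕ} {φ : ℝ} (h : φ ∈ snakeInterval m) (h0 : 0 ≤ φ) :
    0 ≤ sin φ ∧ (m + 1) * sin φ ≤ snakeCurve m φ := by
  have h1 := abs_mul_lt_of_mem_snakeInterval h
  rw [abs_of_nonneg h0] at h1
  have hs : ∀ j : ℕ, j ≤ m + 1 → 0 ≤ sin (j * φ) := by
    intro j hj
    have hj' : (j : ℝ) ≤ m + 1 := by exact_mod_cast hj
    refine sin_nonneg_of_nonneg_of_le_pi (by positivity) ?_
    have := mul_le_mul_of_nonneg_right hj' h0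
    linarith [pi_pos]
  have h2 : 0 ≤ sin φ := by simpa using hs 1 (by omega)
  have h3 := nat_mul_sin_mul_cos_le m (fun j hj => hs j (by omega))
    (cos_pos_of_mem_snakeInterval h).le
  refine ⟨h2, ?_⟩
  have h4 := cos_nat_mul_pos_of_mem_snakeInterval h
  rw [snakeCurve, tan_eq_sin_div_cos, ← mul_div_assoc, add_one_mul, add_comm]
  gcongr
  rw [le_div_iff₀ h4]
  linarith

theorem sin_bounds {m : ℕ} {φ : ℝ} (h : φ ∈ snakeInterval m) :
    0 ≤ snakeCurve m φ * sin φ ∧ (m + 1) * |sin φ| ≤ |snakeCurve m φ| := by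
  have key : ∀ ψ ∈ snakeInterval m, 0 ≤ ψ →
      0 ≤ snakeCurve m ψ * sin ψ ∧ (m + 1) * |sin ψ| ≤ |snakeCurve m ψ| := by
    intro ψ hψ h0
    obtain ⟨h1, h2⟩ := sin_bounds_of_nonneg hψ h0
    have h3 : 0 ≤ snakeCurve m ψ := le_trans (by positivity) h2
    rw [abs_of_nonneg h1, abs_of_nonneg h3]
    exact ⟨by positivity, h2⟩
  rcases le_total 0 φ with h0 | h0
  · exact key φ h h0
  · have := key (-φ) ⟨neg_lt_neg h.2, by linarith [h.1]⟩ (by linarith)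
    simpa [snakeCurve_neg] using this

/-! ### The quantisation condition -/

/-- The phase whose values in `π ℤ` determine the eigenvalues `4 cos θ` of `snakePhi n k`. -/
noncomputable def snakePhase (n : ℕ) (c θ : ℝ) : ℝ := n * θ + 2 * arctan ((c - cos θ) / sin θ)

theorem continuousOn_snakePhase (n : ℕ) (c : ℝ) :
    ContinuousOn (snakePhase n c) (Set.Ioo 0 π) := by
  have h : ContinuousOn (fun θ => (c - cos θ) / sin θ) (Set.Ioo 0 π) :=
    ContinuousOn.div (by fun_prop) (by fun_prop) fun θ hθ => (sin_pos_of_mem_Ioo hθ).ne'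
  exact (by fun_prop : ContinuousOn (fun θ : ℝ => n * θ) _).add
    ((continuous_arctan.comp_continuousOn h).const_smul (2 : ℝ))

theorem strictMonoOn_snakePhase {n : ℕ} (hn : 0 < n) {c : ℝ} (hc : |c| ≤ 1) :
    StrictMonoOn (snakePhase n c) (Set.Ioo 0 π) := by
  intro a ha b hb hab
  have hsa := sin_pos_of_mem_Ioo ha
  have hsb := sin_pos_of_mem_Ioo hb
  have hn' : (0 : ℝ) < n := by exact_mod_cast hn
  -- In the half-sum p and half-difference q, cross-multiplying and cancelling sin q leaves c cos p
  -- ≤ cos q. Strictness of the phase comes from the term nθ.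
  have hle : (c - cos a) / sin a ≤ (c - cos b) / sin b := by
    rw [div_le_div_iff₀ hsa hsb]
    set p := (a + b) / 2 with hp
    set q := (b - a) / 2 with hq
    have ea : a = p - q := by ring
    have eb : b = p + q := by ring
    have hq0 : 0 < sin q := sin_pos_of_pos_of_lt_pi (by linarith) (by linarith [ha.1, hb.2])
    have hpq : |cos p| ≤ cos q := by
      rw [abs_le]
      constructor
      · have : 0 ≤ cos p + cos q := by
          have h2 : 0 ≤ cos (a / 2) * cos (b / 2) :=
            mul_nonneg (cos_nonneg_of_mem_Icc ⟨by linarith [ha.1, pi_pos], by linarith [ha.2]⟩)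
              (cos_nonneg_of_mem_Icc ⟨by linarith [hb.1, pi_pos], by linarith [hb.2]⟩)
          have e1 : p = b / 2 + a / 2 := by ring
          have e2 : q = b / 2 - a / 2 := by ring
          rw [e1, e2, cos_add, cos_sub]
          linarith
        linarith
      · have : 0 ≤ cos q - cos p := by
          have h2 : 0 ≤ sin (a / 2) * sin (b / 2) :=
            mul_nonneg (sin_nonneg_of_mem_Icc ⟨by linarith [ha.1], by linarith [ha.2, pi_pos]⟩)
              (sin_nonneg_of_mem_Icc ⟨by linarith [hb.1], by linarith [hb.2, pi_pos]⟩)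
          have e1 : p = b / 2 + a / 2 := by ring
          have e2 : q = b / 2 - a / 2 := by ring
          rw [e1, e2, cos_add, cos_sub]
          linarith
        linarith
    have h3 : c * cos p ≤ cos q := by
      calc c * cos p ≤ |c * cos p| := le_abs_self _
        _ = |c| * |cos p| := abs_mul _ _
        _ ≤ 1 * |cos p| := by gcongr
        _ ≤ cos q := by rwa [one_mul]
    have h4 := mul_le_mul_of_nonneg_right h3 hq0.le
    rw [ea, eb, sin_sub, sin_add, cos_sub, cos_add]
    have h5 : cos q * sin q * (sin p ^ 2 + cos p ^ 2) = cos q * sin q := by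
      rw [sin_sq_add_cos_sq, mul_one]
    linarith
  have := arctan_strictMono.monotone hle
  have h5 := mul_lt_mul_of_pos_left hab hn'
  simp only [snakePhase]
  linarith

theorem exists_snakePhase_eq (n : ℕ) {c : ℝ} (hc : |c| < 1) {y : ℝ}
    (hy : y ∈ Set.Ioo (-π) ((n + 1) * π)) : ∃ θ ∈ Set.Ioo 0 π, snakePhase n c θ = y := by
  obtain ⟨hc1, hc2⟩ := abs_lt.mp hc
  have hsin0 : Filter.Tendsto sin (nhdsWithin 0 (Set.Ioo 0 π)) (nhdsWithin 0 (Set.Ioi 0)) := by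
    refine tendsto_nhdsWithin_iff.mpr ⟨?_, ?_⟩
    · simpa using (continuous_sin.tendsto 0).mono_left nhdsWithin_le_nhds
    · filter_upwards [self_mem_nhdsWithin] with θ hθ using sin_pos_of_mem_Ioo hθ
  have hsinπ : Filter.Tendsto sin (nhdsWithin π (Set.Ioo 0 π)) (nhdsWithin 0 (Set.Ioi 0)) := by
    refine tendsto_nhdsWithin_iff.mpr ⟨?_, ?_⟩
    · simpa using (continuous_sin.tendsto π).mono_left nhdsWithin_le_nhds
    · filter_upwards [self_mem_nhdsWithin] with θ hθ using sin_pos_of_mem_Ioo hθ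
  have h0 : Filter.Tendsto (snakePhase n c) (nhdsWithin 0 (Set.Ioo 0 π)) (nhds (-π)) := by
    have h1 : Filter.Tendsto (fun θ => (c - cos θ) / sin θ) (nhdsWithin 0 (Set.Ioo 0 π))
        Filter.atBot := by
      have h2 : Filter.Tendsto (fun θ => c - cos θ) (nhdsWithin 0 (Set.Ioo 0 π)) (nhds (c - 1)) := by
        have : Continuous fun θ => c - cos θ := by fun_prop
        simpa using (this.tendsto 0).mono_left nhdsWithin_le_nhds
      exact h2.neg_mul_atTop (by linarith) hsin0.inv_tendsto_nhdsGT_zero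
    have h3 := (tendsto_arctan_atBot.mono_right nhdsWithin_le_nhds).comp h1
    have h4 : Filter.Tendsto (fun θ : ℝ => n * θ) (nhdsWithin 0 (Set.Ioo 0 π)) (nhds 0) := by
      have : Continuous fun θ : ℝ => n * θ := by fun_prop
      simpa using (this.tendsto 0).mono_left nhdsWithin_le_nhds
    have h5 := h4.add (h3.const_mul 2)
    rw [show 0 + 2 * -(π / 2) = -π by ring] at h5
    exact h5
  have hπ : Filter.Tendsto (snakePhase n c) (nhdsWithin π (Set.Ioo 0 π))
      (nhds ((n + 1) * π)) := by
    have h1 : Filter.Tendsto (fun θ => (c - cos θ) / sin θ) (nhdsWithin π (Set.Ioo 0 π))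
        Filter.atTop := by
      have h2 : Filter.Tendsto (fun θ => c - cos θ) (nhdsWithin π (Set.Ioo 0 π)) (nhds (c + 1)) := by
        have : Continuous fun θ => c - cos θ := by fun_prop
        simpa using (this.tendsto π).mono_left nhdsWithin_le_nhds
      exact h2.pos_mul_atTop (by linarith) hsinπ.inv_tendsto_nhdsGT_zero
    have h3 := (tendsto_arctan_atTop.mono_right nhdsWithin_le_nhds).comp h1
    have h4 : Filter.Tendsto (fun θ : ℝ => n * θ) (nhdsWithin π (Set.Ioo 0 π)) (nhds (n * π)) := by
      have : Continuous fun θ : ℝ => n * θ := by fun_prop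
      exact (this.tendsto π).mono_left nhdsWithin_le_nhds
    have h5 := h4.add (h3.const_mul 2)
    rw [show n * π + 2 * (π / 2) = (n + 1) * π by ring] at h5
    exact h5
  have hne0 : (nhdsWithin (0 : ℝ) (Set.Ioo 0 π)).NeBot := left_nhdsWithin_Ioo_neBot pi_pos
  have hneπ : (nhdsWithin π (Set.Ioo 0 π)).NeBot := right_nhdsWithin_Ioo_neBot pi_pos
  exact isPreconnected_Ioo.intermediate_value_Ioo (l₁ := nhdsWithin 0 (Set.Ioo 0 π))
    (l₂ := nhdsWithin π (Set.Ioo 0 π)) inf_le_right inf_le_right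
    (continuousOn_snakePhase n c) h0 hπ hy

/-- With A the arctangent, the hypothesis gives sin(nθ + 2A) = 0 and cos k cos A = cos(θ - A).
Multiplying the claim by cos²A ≠ 0 makes it polynomial in these relations. -/
theorem sin_sq_mul_of_snakePhase_eq {n j : ℕ} {k θ : ℝ} (hθ : θ ∈ Set.Ioo 0 π)
    (h : snakePhase n (cos k) θ = j * π) :
    sin k ^ 2 * sin (n * θ) = 2 * (cos θ - cos k) * sin ((n + 1) * θ) := by
  have hs := sin_pos_of_mem_Ioo hθ
  set A := arctan ((cos k - cos θ) / sin θ) with hA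
  have hcA : cos A ≠ 0 := (cos_arctan_pos _).ne'
  have htan : cos k * cos A = cos θ * cos A + sin θ * sin A := by
    have h1 : tan A = (cos k - cos θ) / sin θ := tan_arctan _
    rw [tan_eq_sin_div_cos, div_eq_div_iff hcA hs.ne'] at h1
    linarith
  have hphase : sin (n * θ) * (2 * cos A ^ 2 - 1) + cos (n * θ) * (2 * sin A * cos A) = 0 := by
    rw [← cos_two_mul, ← sin_two_mul, ← sin_add]
    have : n * θ + 2 * A = j * π := h
    rw [this, sin_nat_mul_pi]
  have h1 := sin_sq_add_cos_sq k
  have h2 := sin_sq_add_cos_sq θ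
  have h3 := sin_sq_add_cos_sq A
  rw [add_one_mul, sin_add]
  apply mul_right_cancel₀ (pow_ne_zero 2 hcA)
  have e1 : sin k ^ 2 * cos A ^ 2 = cos A ^ 2 - (cos θ * cos A + sin θ * sin A) ^ 2 := by
    rw [← htan]; linear_combination cos A ^ 2 * h1
  have e2 : (cos θ - cos k) * cos A = - (sin θ * sin A) := by linear_combination -htan
  have e3 : sin k ^ 2 * sin (n * θ) * cos A ^ 2
      = (cos A ^ 2 - (cos θ * cos A + sin θ * sin A) ^ 2) * sin (n * θ) := by
    rw [← e1]; ring
  have e4 : 2 * (cos θ - cos k) * (sin (n * θ) * cos θ + cos (n * θ) * sin θ) * cos A ^ 2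
      = 2 * (-(sin θ * sin A)) * cos A * (sin (n * θ) * cos θ + cos (n * θ) * sin θ) := by
    rw [← e2]; ring
  rw [e3, e4]
  linear_combination sin θ ^ 2 * hphase - (cos A ^ 2 * sin (n * θ)) * h2
    - sin (n * θ) * sin θ ^ 2 * h3

/-! ### Identification of the median eigenvalue -/

theorem medianEigenvalue_eq_of_strictAnti {m : ℕ} {k : ℝ} {f : Fin (2 * m + 1) → ℝ}
    (hf : StrictAnti f)
    (hv : ∀ i, ∃ v : Fin (2 * m + 1) → ℝ, v ≠ 0 ∧ (snakePhi (2 * m) k).mulVec v = f i • v) :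
    medianEigenvalue (2 * m) k = f ⟨m, by omega⟩ := by
  rw [medianEigenvalue, Matrix.IsHermitian.eigenvalues₀_eq_of_strictAnti _ hf hv]
  congr 1
  apply Fin.ext
  simp

theorem medianEigenvalue_of_sin_ne_zero {m : ℕ} (hm : 0 < m) {k φ : ℝ} (hk : sin k ≠ 0)
    (hφ : φ ∈ snakeInterval m) (h : snakeCurve m φ = cos k) :
    medianEigenvalue (2 * m) k = 4 * sin φ := by
  have hc : |cos k| < 1 := by
    rw [← sq_lt_one_iff_abs_lt_one]
    have := sin_sq_add_cos_sq k
    have : 0 < sin k ^ 2 := by positivity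
    linarith
  have hp := pi_pos
  have hmono := strictMonoOn_snakePhase (n := 2 * m) (by omega) hc.le
  have hex : ∀ j : Fin (2 * m + 1), ∃ θ ∈ Set.Ioo 0 π,
      snakePhase (2 * m) (cos k) θ = (j : ℕ) * π := by
    rintro ⟨j, hj⟩
    have hj' : (j : ℝ) < ((2 * m : ℕ) : ℝ) + 1 := by exact_mod_cast hj
    refine exists_snakePhase_eq _ hc ⟨?_, mul_lt_mul_of_pos_right hj' hp⟩
    have : 0 ≤ (j : ℝ) * π := by positivity
    simp only
    linarith
  choose θ hθ hphase using hex
  have hanti : StrictAnti fun i => 4 * cos (θ i) := by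
    intro a b hab
    have h1 : θ a < θ b := by
      rw [← hmono.lt_iff_lt (hθ a) (hθ b), hphase, hphase]
      have : ((a : ℕ) : ℝ) < (b : ℕ) := by exact_mod_cast hab
      exact mul_lt_mul_of_pos_right this hp
    have := strictAntiOn_cos (Set.Ioo_subset_Icc_self (hθ a)) (Set.Ioo_subset_Icc_self (hθ b)) h1
    simp only
    linarith
  rw [medianEigenvalue_eq_of_strictAnti hanti]
  · have hcos := cos_pos_of_mem_snakeInterval hφ
    have habs := abs_mul_lt_of_mem_snakeInterval hφ
    have hm' : (0 : ℝ) ≤ m := m.cast_nonneg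
    have habs' : |φ| < π / 2 := lt_of_le_of_lt (by nlinarith [abs_nonneg φ]) habs
    have habs'' : |m * φ| < π / 2 := by
      rw [abs_mul, abs_of_nonneg hm']
      nlinarith [abs_nonneg φ]
    obtain ⟨l1, l2⟩ := abs_lt.mp habs'
    obtain ⟨l3, l4⟩ := abs_lt.mp habs''
    have hmem : π / 2 - φ ∈ Set.Ioo 0 π := ⟨by linarith, by linarith⟩
    -- The arctangent equals mφ, so the phase is 2m(π/2 - φ) + 2mφ.
    have heq : snakePhase (2 * m) (cos k) (π / 2 - φ) = m * π := by
      rw [snakePhase, cos_pi_div_two_sub, sin_pi_div_two_sub]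
      have : (cos k - sin φ) / cos φ = tan (m * φ) := by
        rw [← h, snakeCurve]; field_simp; ring
      rw [this, arctan_tan l3 l4]
      push_cast
      ring
    have : θ ⟨m, by omega⟩ = π / 2 - φ := by
      apply hmono.injOn (hθ _) hmem
      rw [hphase, heq]
    rw [this, cos_pi_div_two_sub]
  · intro i
    have hs := sin_pos_of_mem_Ioo (hθ i)
    refine snakePhi_exists_eigenvector (by omega) (a := sin k)
      (b := sin (((2 * m : ℕ) + 1) * θ i)) (Or.inl (mul_ne_zero hk hs.ne')) rfl ?_
    linear_combination sin_sq_mul_of_snakePhase_eq (hθ i) (hphase i)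

/-- The last site decouples: index 0 is its eigenvalue 4, and the others come from the path on n
sites, with θ = iπ/(n+1). -/
theorem medianEigenvalue_of_cos_eq_one {m : ℕ} (hm : 0 < m) {k : ℝ} (hk : cos k = 1) :
    medianEigenvalue (2 * m) k = 4 * sin (π / (2 * (2 * m + 1))) := by
  have hp := pi_pos
  have hsk : sin k = 0 := by
    have := sin_sq_add_cos_sq k
    rw [hk] at this
    exact pow_eq_zero_iff two_ne_zero |>.mp (by linarith)
  have hanti : StrictAnti fun i : Fin (2 * m + 1) => 4 * cos ((i : ℕ) * π / (2 * m + 1)) := by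
    intro a b hab
    have hab' : ((a : ℕ) : ℝ) < (b : ℕ) := by exact_mod_cast hab
    have hb' : ((b : ℕ) : ℝ) ≤ 2 * m + 1 := by exact_mod_cast b.2.le
    have := cos_lt_cos_of_nonneg_of_le_pi (x := (a : ℕ) * π / (2 * m + 1))
      (y := (b : ℕ) * π / (2 * m + 1)) (by positivity)
      (by rw [div_le_iff₀ (by positivity)]; nlinarith) (by gcongr)
    simp only
    linarith
  rw [medianEigenvalue_eq_of_strictAnti hanti]
  · rw [← cos_pi_div_two_sub]
    congr 2
    field_simp
    ring
  · intro i
    rcases Nat.eq_zero_or_pos (i : ℕ) with hi | hi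
    · exact snakePhi_exists_eigenvector (by omega) (a := 0) (b := 1) (Or.inr one_ne_zero)
        (by simp [hsk]) (by simp [hi, hk])
    · refine snakePhi_exists_eigenvector (by omega) (a := 1) (b := 0) (Or.inl ?_) ?_
        (by simp [hsk])
      · have hi1 : (0 : ℝ) < (i : ℕ) := by exact_mod_cast hi
        have hi2 : ((i : ℕ) : ℝ) < 2 * m + 1 := by exact_mod_cast i.2
        rw [one_mul]
        refine (sin_pos_of_pos_of_lt_pi (by positivity) ?_).ne'
        rw [div_lt_iff₀ (by positivity)]
        nlinarith
      · have : (((2 * m : ℕ) : ℝ) + 1) * ((i : ℕ) * π / (2 * m + 1)) = (i : ℕ) * π := by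
          push_cast; field_simp
        rw [this, sin_nat_mul_pi]
        ring

theorem medianEigenvalue_of_cos_eq_neg_one {m : ℕ} (hm : 0 < m) {k : ℝ} (hk : cos k = -1) :
    medianEigenvalue (2 * m) k = -(4 * sin (π / (2 * (2 * m + 1)))) := by
  have hp := pi_pos
  have hsk : sin k = 0 := by
    have := sin_sq_add_cos_sq k
    rw [hk] at this
    exact pow_eq_zero_iff two_ne_zero |>.mp (by linarith)
  -- The decoupled eigenvalue is now -4, the smallest, so the path eigenvalues move up one place:
  -- hence `i + 1`.
  have hanti : StrictAnti fun i : Fin (2 * m + 1) =>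
      4 * cos (((i : ℕ) + 1 : ℕ) * π / (2 * m + 1)) := by
    intro a b hab
    have hab' : (((a : ℕ) + 1 : ℕ) : ℝ) < ((b : ℕ) + 1 : ℕ) := by
      exact_mod_cast Nat.succ_lt_succ hab
    have hb' : (((b : ℕ) + 1 : ℕ) : ℝ) ≤ 2 * m + 1 := by exact_mod_cast Nat.succ_le_of_lt b.2
    have := cos_lt_cos_of_nonneg_of_le_pi (x := ((a : ℕ) + 1 : ℕ) * π / (2 * m + 1))
      (y := ((b : ℕ) + 1 : ℕ) * π / (2 * m + 1)) (by positivity)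
      (by rw [div_le_iff₀ (by positivity)]; nlinarith) (by gcongr)
    simp only
    linarith
  rw [medianEigenvalue_eq_of_strictAnti hanti]
  · rw [← cos_pi_div_two_sub, ← mul_neg, ← cos_pi_sub]
    congr 2
    push_cast
    field_simp
    ring
  · intro i
    rcases Nat.lt_or_ge (i : ℕ) (2 * m) with hi | hi
    · refine snakePhi_exists_eigenvector (by omega) (a := 1) (b := 0) (Or.inl ?_) ?_
        (by simp [hsk])
      · have hi2 : (((i : ℕ) + 1 : ℕ) : ℝ) < 2 * m + 1 := by exact_mod_cast Nat.succ_lt_succ hi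
        rw [one_mul]
        refine (sin_pos_of_pos_of_lt_pi (by positivity) ?_).ne'
        rw [div_lt_iff₀ (by positivity)]
        nlinarith
      · have : (((2 * m : ℕ) : ℝ) + 1) * (((i : ℕ) + 1 : ℕ) * π / (2 * m + 1))
            = ((i : ℕ) + 1 : ℕ) * π := by
          push_cast; field_simp
        rw [this, sin_nat_mul_pi]
        ring
    · have hi' : (i : ℕ) = 2 * m := by omega
      have hθ : (((i : ℕ) + 1 : ℕ) : ℝ) * π / (2 * m + 1) = π := by
        rw [hi']; push_cast; field_simp
      rw [hθ]
      exact snakePhi_exists_eigenvector (by omega) (a := 0) (b := 1) (Or.inr one_ne_zero)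
        (by simp [hsk]) (by simp [hk])

theorem medianEigenvalue_eq {m : ℕ} (hm : 0 < m) (k : ℝ) :
    medianEigenvalue (2 * m) k = 4 * sin (snakeAngle m (cos k)) := by
  have hc : cos k ∈ Set.Icc (-1 : ℝ) 1 := cos_mem_Icc k
  have hmem := snakeAngle_mem hm hc
  have heq := snakeCurve_snakeAngle hm hc
  by_cases hk : sin k = 0
  · have hmem' := pi_div_mem_snakeInterval hm
    rcases sin_eq_zero_iff_cos_eq.mp hk with h | h
    · rw [medianEigenvalue_of_cos_eq_one hm h, (strictMonoOn_snakeCurve hm).injOn hmem hmem'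
        (by rw [heq, h, snakeCurve_pi_div hm])]
    · rw [medianEigenvalue_of_cos_eq_neg_one hm h, (strictMonoOn_snakeCurve hm).injOn hmem
        (show -(π / (2 * (2 * m + 1))) ∈ snakeInterval m from
          ⟨neg_lt_neg hmem'.2, by linarith [hmem'.1]⟩)
        (by rw [heq, h, snakeCurve_neg, snakeCurve_pi_div hm]), sin_neg]
      ring
  · exact medianEigenvalue_of_sin_ne_zero hm hk hmem heq

/-! ### The limit function -/

/-- Because sin²k = 1 - cos²k, this is the double-angle formula for the arctangent. -/
theorem limitLambda_eq : limitLambda = fun k => 8 * arctan (cos k) := by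
  funext k
  rw [limitLambda]
  split_ifs with hk
  · rcases sin_eq_zero_iff_cos_eq.mp hk with h | h
    · rw [h, arctan_one]; ring
    · rw [h, arctan_neg, arctan_one]; ring
  · have hc : |cos k| < 1 := by
      rw [← sq_lt_one_iff_abs_lt_one]
      have := sin_sq_add_cos_sq k
      have : 0 < sin k ^ 2 := by positivity
      linarith
    rw [sin_sq, ← two_mul_arctan (abs_lt.mp hc).1 (abs_lt.mp hc).2]
    ring

theorem contDiff_limitLambda : ContDiff ℝ 2 limitLambda := by
  rw [limitLambda_eq]
  exact contDiff_const.mul (contDiff_arctan.comp contDiff_cos)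

theorem deriv_limitLambda : deriv limitLambda = fun k => -(8 * sin k) / (1 + cos k ^ 2) := by
  funext k
  rw [limitLambda_eq]
  have h := ((hasDerivAt_arctan (cos k)).comp k (hasDerivAt_cos k)).const_mul 8
  refine HasDerivAt.deriv (h.congr_deriv ?_)
  ring

theorem deriv_deriv_limitLambda (k : ℝ) : deriv (deriv limitLambda) k =
    4 * (-(cos k) * (2 / (1 + cos k ^ 2)) - sin k ^ 2 * (4 * cos k / (1 + cos k ^ 2) ^ 2)) := by
  rw [deriv_limitLambda]
  have h0 : 1 + cos k ^ 2 ≠ 0 := by positivity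
  have h := (((hasDerivAt_sin k).const_mul 8).neg).div
    (((hasDerivAt_cos k).pow 2).const_add 1) h0
  refine HasDerivAt.deriv (h.congr_deriv ?_)
  simp only [Pi.pow_apply, Pi.neg_apply]
  field_simp
  ring

/-! ### Estimates for the differential equation -/

/-- The denominator in the differential equation for `sin ∘ snakeAngle`. -/
noncomputable def snakeDenom (n c x : ℝ) : ℝ := n * (1 + c ^ 2) + 2 - 2 * (n + 1) * (c * x)

/-- The right-hand side of the differential equation for `sin ∘ snakeAngle`. -/
noncomputable def snakeSlope (n c x : ℝ) : ℝ := 2 * (1 - x ^ 2) / snakeDenom n c x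

/-- The derivative of `snakeSlope` along a solution. -/
noncomputable def snakeCurvature (n c x : ℝ) : ℝ :=
  (4 * x * snakeSlope n c x + snakeSlope n c x *
    (2 * n * c - 2 * (n + 1) * (x + c * snakeSlope n c x))) / snakeDenom n c x

section Estimates

variable {n c x : ℝ}

theorem abs_le_of_snakeBound (hn : 2 ≤ n) (hx : (n + 2) * |x| ≤ 2 * |c|) : |x| ≤ 2 * |c| / n := by
  rw [le_div_iff₀ (by linarith)]
  nlinarith [abs_nonneg x]

theorem mul_le_of_snakeBound (ht : 0 ≤ c * x) (hx : (n + 2) * |x| ≤ 2 * |c|) :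
    (n + 2) * (c * x) ≤ 2 * c ^ 2 := by
  have h1 : c * x = |c| * |x| := by rw [← abs_mul, abs_of_nonneg ht]
  rw [h1, ← sq_abs c]
  nlinarith [abs_nonneg c]

theorem snakeDenom_ge (hn : 2 ≤ n) (hc : c ^ 2 ≤ 1) (ht : 0 ≤ c * x)
    (hx : (n + 2) * |x| ≤ 2 * |c|) : n ≤ snakeDenom n c x := by
  have h1 := mul_le_of_snakeBound ht hx
  rw [snakeDenom]
  have h2 : 2 * (n + 1) * (c * x) ≤ (n + 2) * c ^ 2 := by
    have h3 : (n + 2) * (2 * (n + 1) * (c * x)) ≤ (n + 2) * ((n + 2) * c ^ 2) := by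
      nlinarith [mul_nonneg (sq_nonneg n) (sq_nonneg c)]
    exact le_of_mul_le_mul_left h3 (by linarith)
  nlinarith

theorem abs_snakeDenom_sub_le (hn : 2 ≤ n) (hc : c ^ 2 ≤ 1) (ht : 0 ≤ c * x)
    (hx : (n + 2) * |x| ≤ 2 * |c|) : |n * (1 + c ^ 2) - snakeDenom n c x| ≤ 2 := by
  have h1 := mul_le_of_snakeBound ht hx
  rw [snakeDenom, abs_le]
  constructor <;> nlinarith

/-- The quantity bounded is the ratio of λ' to Λ'/n wherever Λ' ≠ 0. -/
theorem snakeSlope_mul_mem (hn : 2 ≤ n) (hc : c ^ 2 ≤ 1) (ht : 0 ≤ c * x)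
    (hx : (n + 2) * |x| ≤ 2 * |c|) :
    snakeSlope n c x * (n * (1 + c ^ 2)) / 2 ∈ Set.Icc (1 - 2 / n) (1 + 2 / n) := by
  have hn0 : 0 < n := by linarith
  have hQ : 0 < snakeDenom n c x := lt_of_lt_of_le hn0 (snakeDenom_ge hn hc ht hx)
  have h1 := mul_le_of_snakeBound ht hx
  have h2 : snakeSlope n c x * (n * (1 + c ^ 2)) / 2
      = n * (1 + c ^ 2) * (1 - x ^ 2) / snakeDenom n c x := by
    rw [snakeSlope]; ring
  have h3 : n ^ 2 * x ^ 2 ≤ n * c ^ 2 := by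
    have h4 := pow_le_pow_left₀ (by positivity) hx 2
    rw [mul_pow, mul_pow, sq_abs, sq_abs] at h4
    -- (n + 2)² ≥ 8n, because (n - 2)² ≥ 0.
    have h5 : 8 * n * x ^ 2 ≤ 4 * c ^ 2 := by nlinarith [mul_nonneg (sq_nonneg (n - 2)) (sq_nonneg x)]
    nlinarith
  rw [h2, show 1 - 2 / n = (n - 2) / n by field_simp, show 1 + 2 / n = (n + 2) / n by field_simp]
  constructor
  · rw [div_le_div_iff₀ hn0 hQ, snakeDenom]
    have h6 : n ^ 2 * x ^ 2 * (1 + c ^ 2) ≤ n * c ^ 2 * 2 :=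
      mul_le_mul h3 (by linarith) (by positivity) (by positivity)
    have h7 : 0 ≤ (n + 1) * (n - 2) * (c * x) :=
      mul_nonneg (mul_nonneg (by linarith) (by linarith)) ht
    nlinarith
  · rw [div_le_div_iff₀ hQ hn0, snakeDenom]
    have h6 : 0 ≤ n ^ 2 * x ^ 2 * (1 + c ^ 2) := by positivity
    nlinarith [mul_le_mul_of_nonneg_left h1 (by linarith : 0 ≤ n + 1)]

theorem snakeSlope_mem (hn : 2 ≤ n) (hc : c ^ 2 ≤ 1) (ht : 0 ≤ c * x)
    (hx : (n + 2) * |x| ≤ 2 * |c|) : snakeSlope n c x ∈ Set.Icc 0 (2 / n) := by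
  have hn0 : 0 < n := by linarith
  have hQ' := snakeDenom_ge hn hc ht hx
  have hQ : 0 < snakeDenom n c x := lt_of_lt_of_le hn0 hQ'
  have h1 := abs_le_of_snakeBound hn hx
  have h2 : |x| ≤ 1 := by
    refine h1.trans ?_
    rw [div_le_one hn0]
    have := (sq_le_one_iff_abs_le_one c).mp hc
    linarith
  have h3 := (sq_le_one_iff_abs_le_one x).mpr h2
  rw [snakeSlope]
  refine ⟨div_nonneg (by linarith) hQ.le, ?_⟩
  exact div_le_div₀ (by norm_num) (by linarith [sq_nonneg x]) hn0 hQ'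

theorem abs_snakeSlope_sub_le (hn : 2 ≤ n) (hc : c ^ 2 ≤ 1) (ht : 0 ≤ c * x)
    (hx : (n + 2) * |x| ≤ 2 * |c|) :
    |snakeSlope n c x - 2 / (n * (1 + c ^ 2))| ≤ 4 / n ^ 2 := by
  have hn0 : 0 < n := by linarith
  obtain ⟨h1, h2⟩ := snakeSlope_mul_mem hn hc ht hx
  have h3 : |snakeSlope n c x * (n * (1 + c ^ 2)) / 2 - 1| ≤ 2 / n := by
    rw [abs_le]; constructor <;> linarith
  have h4 : snakeSlope n c x - 2 / (n * (1 + c ^ 2))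
      = (snakeSlope n c x * (n * (1 + c ^ 2)) / 2 - 1) * (2 / (n * (1 + c ^ 2))) := by
    field_simp
  have h5 : 2 / (n * (1 + c ^ 2)) ≤ 2 / n := by
    apply div_le_div_of_nonneg_left (by norm_num) hn0
    nlinarith [sq_nonneg c]
  rw [h4, abs_mul, abs_of_nonneg (by positivity : 0 ≤ 2 / (n * (1 + c ^ 2)))]
  calc _ ≤ 2 / n * (2 / n) := by gcongr
    _ = 4 / n ^ 2 := by ring

theorem abs_snakeCurvature_sub_le (hn : 2 ≤ n) (hc : c ^ 2 ≤ 1) (ht : 0 ≤ c * x)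
    (hx : (n + 2) * |x| ≤ 2 * |c|) :
    |snakeCurvature n c x - 4 * c / (n * (1 + c ^ 2) ^ 2)| ≤ 48 * |c| / n ^ 2 := by
  have hn0 : 0 < n := by linarith
  have hQ' := snakeDenom_ge hn hc ht hx
  have hQ : 0 < snakeDenom n c x := lt_of_lt_of_le hn0 hQ'
  have hx' := abs_le_of_snakeBound hn hx
  obtain ⟨hR0, hR⟩ := snakeSlope_mem hn hc ht hx
  have hE := abs_snakeSlope_sub_le hn hc ht hx
  have hD := abs_snakeDenom_sub_le hn hc ht hx
  rw [snakeCurvature]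
  set R := snakeSlope n c x
  set Q := snakeDenom n c x
  set w := 1 + c ^ 2 with hw
  have hw1 : 1 ≤ w := by rw [hw]; linarith [sq_nonneg c]
  have hQi : 1 / Q ≤ 1 / n := one_div_le_one_div_of_le hn0 hQ'
  have hQi0 : 0 ≤ 1 / Q := by positivity
  have hRQ : R * (1 / Q) ≤ 2 / n * (1 / n) := by gcongr
  have hnw : n ≤ n * w := by nlinarith
  -- Only 2ncR/Q has order 1/n. Replacing R by 2/(nw) and then 1/Q by 1/(nw) turns it into 4c/(nw²);
  -- every remaining term is O(|c|/n²).
  have key : (4 * x * R + R * (2 * n * c - 2 * (n + 1) * (x + c * R))) / Q - 4 * c / (n * w ^ 2)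
      = 4 * x * (R * (1 / Q)) + 2 * n * c * ((R - 2 / (n * w)) * (1 / Q))
        + 2 * n * c * (2 / (n * w) * ((n * w - Q) * (1 / (n * w)) * (1 / Q)))
        - 2 * (n + 1) * ((x + c * R) * (R * (1 / Q))) := by
    field_simp
    ring
  have t1 : |4 * x * (R * (1 / Q))| ≤ 8 * |c| / n ^ 2 := by
    rw [abs_mul, abs_mul, abs_of_nonneg (mul_nonneg hR0 hQi0), abs_of_pos (by norm_num : (0:ℝ) < 4)]
    calc _ ≤ 4 * (2 * |c| / n) * (2 / n * (1 / n)) := by gcongr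
      _ = 8 * |c| / n ^ 2 * (2 / n) := by ring
      _ ≤ 8 * |c| / n ^ 2 * 1 := by
        gcongr
        rwa [div_le_one hn0]
      _ = _ := mul_one _
  have t2 : |2 * n * c * ((R - 2 / (n * w)) * (1 / Q))| ≤ 8 * |c| / n ^ 2 := by
    rw [abs_mul, abs_mul, abs_mul _ (1 / Q), abs_of_nonneg hQi0,
      abs_of_pos (by linarith : 0 < 2 * n)]
    calc _ ≤ 2 * n * |c| * (4 / n ^ 2 * (1 / n)) := by gcongr
      _ = _ := by field_simp; ring
  have t3 : |2 * n * c * (2 / (n * w) * ((n * w - Q) * (1 / (n * w)) * (1 / Q)))|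
      ≤ 8 * |c| / n ^ 2 := by
    rw [abs_mul, abs_mul, abs_mul (2 / (n * w)), abs_mul _ (1 / Q), abs_mul (n * w - Q),
      abs_of_nonneg hQi0, abs_of_pos (by linarith : 0 < 2 * n),
      abs_of_pos (by positivity : 0 < 2 / (n * w)), abs_of_pos (by positivity : 0 < 1 / (n * w))]
    calc _ ≤ 2 * n * |c| * (2 / n * (2 * (1 / n) * (1 / n))) := by gcongr
      _ = _ := by field_simp; ring
  have t4 : |2 * (n + 1) * ((x + c * R) * (R * (1 / Q)))| ≤ 24 * |c| / n ^ 2 := by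
    have h1 : |x + c * R| ≤ 2 * |c| / n + |c| * (2 / n) := by
      refine (abs_add_le _ _).trans ?_
      rw [abs_mul, abs_of_nonneg hR0]
      gcongr
    have h2 : (n + 1) / n ≤ 3 / 2 := by
      rw [div_le_div_iff₀ hn0 (by norm_num)]
      linarith
    rw [abs_mul, abs_mul (x + c * R), abs_of_nonneg (mul_nonneg hR0 hQi0),
      abs_of_pos (by linarith : 0 < 2 * (n + 1))]
    calc _ ≤ 2 * (n + 1) * ((2 * |c| / n + |c| * (2 / n)) * (2 / n * (1 / n))) := by gcongr
      _ = 16 * |c| / n ^ 2 * ((n + 1) / n) := by field_simp; ring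
      _ ≤ 16 * |c| / n ^ 2 * (3 / 2) := by
        exact mul_le_mul_of_nonneg_left h2 (by positivity)
      _ = _ := by ring
  rw [key]
  have e : 48 * |c| / n ^ 2
      = 8 * |c| / n ^ 2 + 8 * |c| / n ^ 2 + 8 * |c| / n ^ 2 + 24 * |c| / n ^ 2 := by ring
  rw [e]
  refine (abs_sub _ _).trans (add_le_add ?_ t4)
  exact (abs_add_le _ _).trans (add_le_add ((abs_add_le _ _).trans (add_le_add t1 t2)) t3)

end Estimates

/-! ### Derivatives of the median eigenvalue and the comparison with Λ -/

theorem snakeAngle_bounds {m : ℕ} (hm : 0 < m) (k : ℝ) :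
    0 ≤ cos k * sin (snakeAngle m (cos k)) ∧
      (2 * (m : ℝ) + 2) * |sin (snakeAngle m (cos k))| ≤ 2 * |cos k| := by
  have h := sin_bounds (snakeAngle_mem hm (cos_mem_Icc k))
  rw [snakeCurve_snakeAngle hm (cos_mem_Icc k)] at h
  exact ⟨h.1, by linarith [h.2]⟩

theorem contDiff_sin_snakeAngle_cos {m : ℕ} (hm : 0 < m) :
    ContDiff ℝ 2 fun k => sin (snakeAngle m (cos k)) := by
  rw [contDiff_iff_contDiffAt]
  intro k
  exact contDiff_sin.contDiffAt.comp k
    ((snakeAngle_contDiffAt_hasDerivAt hm (cos_mem_Icc k)).1.comp k contDiff_cos.contDiffAt)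

theorem hasDerivAt_sin_snakeAngle_cos {m : ℕ} (hm : 0 < m) (k : ℝ) :
    HasDerivAt (fun k => sin (snakeAngle m (cos k)))
      (-sin k * snakeSlope (2 * m) (cos k) (sin (snakeAngle m (cos k)))) k := by
  have hc := cos_mem_Icc k
  have hJ := snakeAngle_mem hm hc
  have h1 := (snakeAngle_contDiffAt_hasDerivAt hm hc).2.comp k (hasDerivAt_cos k)
  have h2 := h1.sin
  refine h2.congr_deriv ?_
  have h3 := snakeCurveDeriv_mul_cos hJ
  rw [snakeCurve_snakeAngle hm hc] at h3
  have h4 := cos_pos_of_mem_snakeInterval hJ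
  have h5 := snakeCurveDeriv_pos hm hJ
  have h6 : snakeDenom (2 * m) (cos k) (sin (snakeAngle m (cos k)))
      = 2 * (snakeCurveDeriv m (snakeAngle m (cos k)) * cos (snakeAngle m (cos k))) := by
    rw [h3, snakeDenom]; ring
  rw [snakeSlope, h6, ← cos_sq']
  simp only [Function.comp]
  field_simp

/-- `snakeCurvature` is minus the derivative of the slope with respect to c; together with dc/dk =
-sin k this gives the term -sin²k. -/
theorem hasDerivAt_snakeSlope {m : ℕ} (hm : 0 < m) (k : ℝ) :
    HasDerivAt (fun k => -sin k * snakeSlope (2 * m) (cos k) (sin (snakeAngle m (cos k))))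
      (-cos k * snakeSlope (2 * m) (cos k) (sin (snakeAngle m (cos k)))
        - sin k ^ 2 * snakeCurvature (2 * m) (cos k) (sin (snakeAngle m (cos k)))) k := by
  have hm' : (2 : ℝ) ≤ 2 * m := by
    have : (1 : ℝ) ≤ m := by exact_mod_cast hm
    linarith
  obtain ⟨ht, hx⟩ := snakeAngle_bounds hm k
  have hQ : snakeDenom (2 * m) (cos k) (sin (snakeAngle m (cos k))) ≠ 0 := by
    have := snakeDenom_ge hm' (cos_sq_le_one k) ht hx
    exact (by linarith : 0 < snakeDenom (2 * m) (cos k) (sin (snakeAngle m (cos k)))).ne'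
  have hσ := hasDerivAt_sin_snakeAngle_cos hm k
  have hden : HasDerivAt
      (fun k => snakeDenom (2 * m) (cos k) (sin (snakeAngle m (cos k)))) _ k :=
    ((((hasDerivAt_cos k).pow 2).const_add 1).const_mul (2 * (m : ℝ))).add_const 2 |>.sub
      (((hasDerivAt_cos k).mul hσ).const_mul (2 * (2 * (m : ℝ) + 1)))
  have hslope : HasDerivAt
      (fun k => snakeSlope (2 * m) (cos k) (sin (snakeAngle m (cos k)))) _ k :=
    (((hσ.pow 2).const_sub 1).const_mul 2).div hden hQ
  refine ((hasDerivAt_sin k).neg.mul hslope).congr_deriv ?_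
  simp only [Pi.pow_apply, Pi.neg_apply]
  rw [snakeCurvature]
  set R := snakeSlope (2 * m) (cos k) (sin (snakeAngle m (cos k))) with hR
  rw [snakeSlope, eq_div_iff hQ] at hR
  generalize snakeDenom (2 * m) (cos k) (sin (snakeAngle m (cos k))) = Q at hQ hR ⊢
  generalize sin (snakeAngle m (cos k)) = x at hR ⊢
  rw [← hR]
  field_simp
  ring

theorem deriv_medianEigenvalue {m : ℕ} (hm : 0 < m) :
    deriv (medianEigenvalue (2 * m)) = fun k =>
      4 * (-sin k * snakeSlope (2 * m) (cos k) (sin (snakeAngle m (cos k)))) := by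
  funext k
  rw [funext (medianEigenvalue_eq hm)]
  exact ((hasDerivAt_sin_snakeAngle_cos hm k).const_mul 4).deriv

theorem deriv_deriv_medianEigenvalue {m : ℕ} (hm : 0 < m) (k : ℝ) :
    deriv (deriv (medianEigenvalue (2 * m))) k =
      4 * (-cos k * snakeSlope (2 * m) (cos k) (sin (snakeAngle m (cos k)))
        - sin k ^ 2 * snakeCurvature (2 * m) (cos k) (sin (snakeAngle m (cos k)))) := by
  rw [deriv_medianEigenvalue hm]
  exact ((hasDerivAt_snakeSlope hm k).const_mul 4).deriv

theorem deriv_medianEigenvalue_mem {m : ℕ} (hm : 0 < m) (k : ℝ) :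
    deriv (medianEigenvalue (2 * m)) k ∈
      Set.uIcc (deriv limitLambda k / (2 * m : ℝ) * (1 - 2 / (2 * m : ℝ)))
        (deriv limitLambda k / (2 * m : ℝ) * (1 + 2 / (2 * m : ℝ))) := by
  have hm' : (2 : ℝ) ≤ 2 * m := by
    have : (1 : ℝ) ≤ m := by exact_mod_cast hm
    linarith
  obtain ⟨ht, hx⟩ := snakeAngle_bounds hm k
  obtain ⟨h1, h2⟩ := snakeSlope_mul_mem hm' (cos_sq_le_one k) ht hx
  rw [deriv_medianEigenvalue hm]
  have hm0 : (m : ℝ) ≠ 0 := by exact_mod_cast hm.ne'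
  set R := snakeSlope (2 * m) (cos k) (sin (snakeAngle m (cos k)))
  set L := deriv limitLambda k / (2 * m : ℝ) with hL
  have e : 4 * (-sin k * R) = L * (R * (2 * m * (1 + cos k ^ 2)) / 2) := by
    rw [hL, deriv_limitLambda]
    field_simp
    ring
  simp only
  rw [e]
  rcases le_total 0 L with hL0 | hL0
  · exact Set.mem_uIcc_of_le (mul_le_mul_of_nonneg_left h1 hL0) (mul_le_mul_of_nonneg_left h2 hL0)
  · exact Set.mem_uIcc_of_ge (mul_le_mul_of_nonpos_left h2 hL0) (mul_le_mul_of_nonpos_left h1 hL0)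

/-- The constant is 4(4 + 48), from the slope and curvature errors. The factor |cos k| is kept for
the zero set of λ''. -/
theorem abs_deriv_deriv_medianEigenvalue_sub_le {m : ℕ} (hm : 0 < m) (k : ℝ) :
    |deriv (deriv (medianEigenvalue (2 * m))) k - deriv (deriv limitLambda) k / (2 * m : ℝ)|
      ≤ 208 * |cos k| / (2 * m : ℝ) ^ 2 := by
  have hm' : (2 : ℝ) ≤ 2 * m := by
    have : (1 : ℝ) ≤ m := by exact_mod_cast hm
    linarith
  obtain ⟨ht, hx⟩ := snakeAngle_bounds hm k
  have h1 := abs_snakeSlope_sub_le hm' (cos_sq_le_one k) ht hx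
  have h2 := abs_snakeCurvature_sub_le hm' (cos_sq_le_one k) ht hx
  rw [deriv_deriv_medianEigenvalue hm, deriv_deriv_limitLambda]
  generalize snakeSlope (2 * m) (cos k) (sin (snakeAngle m (cos k))) = R at h1 ⊢
  generalize snakeCurvature (2 * m) (cos k) (sin (snakeAngle m (cos k))) = V at h2 ⊢
  generalize 2 * (m : ℝ) = n at hm' h1 h2 ⊢
  have hn0 : 0 < n := by linarith
  have e : 4 * (-cos k * R - sin k ^ 2 * V)
      - 4 * (-(cos k) * (2 / (1 + cos k ^ 2)) - sin k ^ 2 * (4 * cos k / (1 + cos k ^ 2) ^ 2)) / n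
      = -(4 * (cos k * (R - 2 / (n * (1 + cos k ^ 2)))
        + sin k ^ 2 * (V - 4 * cos k / (n * (1 + cos k ^ 2) ^ 2)))) := by
    field_simp
    ring
  rw [e, abs_neg, abs_mul, abs_of_pos (by norm_num : (0 : ℝ) < 4)]
  have h3 : |cos k * (R - 2 / (n * (1 + cos k ^ 2)))| ≤ |cos k| * (4 / n ^ 2) := by
    rw [abs_mul]; gcongr
  have h4 : |sin k ^ 2 * (V - 4 * cos k / (n * (1 + cos k ^ 2) ^ 2))|
      ≤ 1 * (48 * |cos k| / n ^ 2) := by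
    rw [abs_mul, abs_of_nonneg (sq_nonneg (sin k))]
    gcongr
    exact sin_sq_le_one k
  calc _ ≤ 4 * (|cos k| * (4 / n ^ 2) + 1 * (48 * |cos k| / n ^ 2)) := by
        gcongr
        exact (abs_add_le _ _).trans (add_le_add h3 h4)
    _ = _ := by ring

theorem four_mul_abs_cos_le_abs_deriv_deriv_limitLambda (k : ℝ) :
    4 * |cos k| ≤ |deriv (deriv limitLambda) k| := by
  have e : deriv (deriv limitLambda) k
      = -(cos k * (8 * (3 - cos k ^ 2) / (1 + cos k ^ 2) ^ 2)) := by
    rw [deriv_deriv_limitLambda, sin_sq]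
    field_simp
    ring
  have hc := cos_sq_le_one k
  -- The quotient decreases in cos²k and equals 4 at cos²k = 1.
  have h : 4 ≤ 8 * (3 - cos k ^ 2) / (1 + cos k ^ 2) ^ 2 := by
    rw [le_div_iff₀ (by positivity)]
    nlinarith [sq_nonneg (cos k)]
  rw [e, abs_neg, abs_mul, mul_comm]
  exact mul_le_mul_of_nonneg_left (h.trans (le_abs_self _)) (abs_nonneg _)

/-- If λ'' = 0, then 4|cos k|/n ≤ 208|cos k|/n², which forces cos k = 0 as soon as n > 52. -/
theorem deriv_deriv_medianEigenvalue_eq_zero_iff {m : ℕ} (hm : 53 ≤ 2 * m) (k : ℝ) :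
    deriv (deriv (medianEigenvalue (2 * m))) k = 0 ↔ cos k = 0 := by
  have h := abs_deriv_deriv_medianEigenvalue_sub_le (by omega : 0 < m) k
  have hm' : (53 : ℝ) ≤ 2 * m := by exact_mod_cast hm
  generalize 2 * (m : ℝ) = n at hm' h
  have hn0 : 0 < n := by linarith
  constructor
  · intro h0
    have h1 := four_mul_abs_cos_le_abs_deriv_deriv_limitLambda k
    rw [h0, zero_sub, abs_neg, abs_div, abs_of_pos hn0, div_le_div_iff₀ hn0 (by positivity)] at h
    have h2 : |deriv (deriv limitLambda) k| * n ≤ 208 * |cos k| :=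
      le_of_mul_le_mul_right (by linarith) hn0
    have h3 : 4 * |cos k| * 53 ≤ |deriv (deriv limitLambda) k| * n :=
      mul_le_mul h1 hm' (by norm_num) (abs_nonneg _)
    exact abs_eq_zero.mp (le_antisymm (by linarith) (abs_nonneg _))
  · intro h0
    rw [deriv_deriv_limitLambda k, h0] at h
    simpa using h

theorem lemma4 :
    ContDiff ℝ 2 limitLambda ∧
    (∀ n : ℕ, 0 < n → Even n → ContDiff ℝ 2 (medianEigenvalue n)) ∧
    (∀ n : ℕ, 0 < n → Even n → ∀ k : ℝ,
      deriv (medianEigenvalue n) k ∈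
        Set.uIcc (deriv limitLambda k / (n : ℝ) * (1 - 2 / (n : ℝ)))
          (deriv limitLambda k / (n : ℝ) * (1 + 2 / (n : ℝ)))) ∧
    (∃ a : ℝ, 0 < a ∧ ∀ n : ℕ, 0 < n → Even n → ∀ k : ℝ,
      |deriv (deriv (medianEigenvalue n)) k - deriv (deriv limitLambda) k / (n : ℝ)|
        ≤ a / (n : ℝ) ^ 2) ∧
    (∃ n₀ : ℕ, ∀ n : ℕ, n₀ ≤ n → 0 < n → Even n → ∀ k : ℝ,
      deriv (deriv (medianEigenvalue n)) k = 0 ↔ ∃ m : ℤ, k = π / 2 + m * π) := by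
  refine ⟨contDiff_limitLambda, ?_, ?_, ⟨208, by norm_num, ?_⟩, ⟨53, ?_⟩⟩
  · rintro n hn ⟨m, rfl⟩
    rw [← two_mul, funext (medianEigenvalue_eq (by omega : 0 < m))]
    exact contDiff_const.mul (contDiff_sin_snakeAngle_cos (by omega))
  · rintro n hn ⟨m, rfl⟩ k
    rw [← two_mul]
    push_cast
    exact deriv_medianEigenvalue_mem (by omega) k
  · rintro n hn ⟨m, rfl⟩ k
    rw [← two_mul]
    push_cast
    refine (abs_deriv_deriv_medianEigenvalue_sub_le (by omega) k).trans ?_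
    gcongr
    linarith [abs_cos_le_one k]
  · rintro n h53 hn ⟨m, rfl⟩ k
    rw [← two_mul] at h53 ⊢
    rw [deriv_deriv_medianEigenvalue_eq_zero_iff h53, cos_eq_zero_iff]
    refine exists_congr fun j => ?_
    rw [show (2 * (j : ℝ) + 1) * π / 2 = π / 2 + j * π by ring]
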